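/- All rings are associative with identity $1\neq 0$. A ring $R$ is called: (a) D-regularly nil clean if for every $a\in R$ there is an idempotent $e\in aRa$ such that $a(1-e)$ is nilpotent; it is D-regularly nil clean of index at most $k$ ($k$ a positive integer) if for every $a\in R$ such an $e$ can be chosen with $[a(1-e)]^k=0$, and of index $k$ if $k$ is the least positive integer with this property; (b) unit-regular if for every $a\in R$ there is a unit $u\in R$ with $a=aua$; (c) strongly clean if every $r\in R$ can be written $r=u+e$ with $u$ a unit, $e$ an idempotent and $ue=eu$; (d) nil-clean if every $r\in R$ can be written $r=q+e$ with $q$ nilpotent and $e$ idempotent; (e) strongly $\pi$-regular if for every $a\in R$ there is a positive integer $n$ with $a^n\in a^{n+1}R\cap Ra^{n+1}$. Statement. The ring $R=\prod_{n\ge 1}\mathbb{M}_n(\mathbb{Z}/2\mathbb{Z})$ is D-regularly nil clean of index $2$, unit-regular, strongly clean and nil-clean, but it is not strongly $\pi$-regular. Consequently, it is not true that every D-regularly nil clean ring is strongly $\pi$-regular. -/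

import Mathlib

/-- `R` is unit-regular: every `a` can be written `a = a * u * a` with a unit `u`. -/
def IsUnitRegularRing (R : Type*) [Ring R] : Prop :=
  ∀ a : R, ∃ u : R, IsUnit u ∧ a = a * u * a

/-- `R` is strongly π-regular: for every `a` there is a positive `n` with
`a ^ n ∈ a ^ (n + 1) R ∩ R a ^ (n + 1)`. -/
def IsStronglyPiRegularRing (R : Type*) [Ring R] : Prop :=
  ∀ a : R, ∃ n : ℕ, 0 < n ∧
    (∃ x : R, a ^ n = a ^ (n + 1) * x) ∧ (∃ y : R, a ^ n = y * a ^ (n + 1))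

/-- `R` is strongly clean: every element is the sum of a unit and an idempotent that commute. -/
def IsStronglyCleanRing (R : Type*) [Ring R] : Prop :=
  ∀ r : R, ∃ u e : R, IsUnit u ∧ IsIdempotentElem e ∧ r = u + e ∧ u * e = e * u

/-- `R` is nil-clean: every element is the sum of a nilpotent and an idempotent. -/
def IsNilCleanRing (R : Type*) [Ring R] : Prop :=
  ∀ r : R, ∃ q e : R, IsNilpotent q ∧ IsIdempotentElem e ∧ r = q + e

/-- `R` is D-regularly nil clean: for every `a` there is an idempotent `e ∈ aRa` with
`a * (1 - e)` nilpotent. -/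
def IsDRegularlyNilCleanRing (R : Type*) [Ring R] : Prop :=
  ∀ a : R, ∃ e : R, (∃ r : R, e = a * r * a) ∧ IsIdempotentElem e ∧ IsNilpotent (a * (1 - e))

/-- `R` is D-regularly nil clean of index at most `k`, for a positive integer `k`: for every `a`
there is an idempotent `e ∈ aRa` with `(a * (1 - e)) ^ k = 0`. -/
def IsDRegularlyNilCleanRingOfIndexAtMost (R : Type*) [Ring R] (k : ℕ) : Prop :=
  0 < k ∧ ∀ a : R, ∃ e : R, (∃ r : R, e = a * r * a) ∧ IsIdempotentElem e ∧
    (a * (1 - e)) ^ k = 0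

/-- `R` is D-regularly nil clean of index `k`: `k` is the least positive integer such that `R` is
D-regularly nil clean of index at most `k`. -/
def IsDRegularlyNilCleanRingOfIndex (R : Type*) [Ring R] (k : ℕ) : Prop :=
  IsLeast {j : ℕ | IsDRegularlyNilCleanRingOfIndexAtMost R j} k

/-- The direct product of the full matrix rings `M_n(ℤ/2)` over all positive integers `n`. -/
abbrev ProdMatrixZModTwo : Type :=
  ∀ n : ℕ+, Matrix (Fin (n : ℕ)) (Fin (n : ℕ)) (ZMod 2)

/-!
Unit-regularity and strong cleanness are checked one matrix at a time. Over `ℤ/2` a diagonal matrix is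
idempotent, so writing `a = P * D * Q` with `P`, `Q` products of transvections and `D` diagonal gives
`a = a * (Q⁻¹ * P⁻¹) * a`; this is unit-regularity. In a unit-regular ring choose `r` with
`a² * r * a² = a²` and `r * a² * r = r`; then `e = a * r * a` is idempotent and `a * (1 - e) * a = 0`,
so the index is at most two. It is not one because of the nonzero square-zero shift in `M_2`.
Strong cleanness holds in any finite ring: if `a ^ k` is idempotent, then `1 - a ^ k` is the
idempotent to subtract. The family of nilpotent shifts, of unbounded index, is not strongly
π-regular.

For nil-cleanness of the product, each matrix `C` must be written as an idempotent plus a nilpotent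
whose index is bounded independently of the size (`Matrix.isNilCleanElem_zmod_two`, with bound `5`).
By the structure theorem for torsion `K[X]`-modules, `C` may be taken to be multiplication by `X` on
`K[X] / (f)`, where `K = ℤ/2`. Such an operator has, for every sequence `δ`, a basis `u` with
`C (u i) = u (i + 1) + δ i • u i`, except at the last vector. For the sequence `pairShift m`, which
vanishes on the first `m` indices and then alternates `0, 1`, the arrows `u i ↦ u (i + 1)` and the
diagonal are shared out between an idempotent `e`, taking the first arrow of each pair together with
the diagonal entry `1`, and a map `q` consisting of the other arrows, which are composable only
among the first `m + 1` vectors. What remains is the image of the last vector `x`. If its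
`x`-coordinate is `1`, then it is `x + z + s` with `z ∈ ker e` and `s ∈ ker q`, and a rank-one
correction of `e` by `x + z` and of `q` by `s` finishes the decomposition (`isNilCleanElem_border`).
That coordinate is the trace of `C` minus the number of pairs, so it changes when `m` is increased
by two: one of the values `m ≤ 3` of the right parity works, unless the dimension is at most two,
where `C ^ 2` is a scalar.
-/

/-! ### Elements that are nil-clean of bounded index -/

/-- `a` differs from an idempotent by an element whose `k`-th power vanishes. -/
def IsNilCleanElem {R : Type*} [Ring R] (k : ℕ) (a : R) : Prop :=
  ∃ e : R, IsIdempotentElem e ∧ (a - e) ^ k = 0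

namespace IsNilCleanElem

theorem map {R S : Type*} [Ring R] [Ring S] (f : R →+* S) {k : ℕ} {a : R}
    (h : IsNilCleanElem k a) : IsNilCleanElem k (f a) := by
  obtain ⟨e, he, hk⟩ := h
  exact ⟨f e, he.map f, by rw [← map_sub, ← map_pow, hk, map_zero]⟩

theorem mono {R : Type*} [Ring R] {k l : ℕ} (hkl : k ≤ l) {a : R}
    (h : IsNilCleanElem k a) : IsNilCleanElem l a := by
  obtain ⟨e, he, hk⟩ := h
  exact ⟨e, he, pow_eq_zero_of_le hkl hk⟩

theorem pi {ι : Type*} {R : ι → Type*} [∀ i, Ring (R i)] {k : ℕ} {a : ∀ i, R i}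
    (h : ∀ i, IsNilCleanElem k (a i)) : IsNilCleanElem k a := by
  choose e he hk using h
  exact ⟨e, funext he, funext hk⟩

theorem of_linearEquiv {K M N : Type*} [Field K] [AddCommGroup M] [Module K M]
    [AddCommGroup N] [Module K N] (φ : M ≃ₗ[K] N) {a : Module.End K M} {b : Module.End K N}
    (hab : ∀ m, φ (a m) = b (φ m)) {k : ℕ} (h : IsNilCleanElem k b) : IsNilCleanElem k a := by
  have := h.map (φ.symm.conjRingEquiv : Module.End K N →+* Module.End K M)
  convert this using 1
  ext m
  simp [← hab]

end IsNilCleanElem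

/-- The ring homomorphism letting a family of endomorphisms act coordinatewise. -/
def piEndHom (K : Type*) {ι : Type*} [Field K] (M : ι → Type*) [∀ i, AddCommGroup (M i)]
    [∀ i, Module K (M i)] : (∀ i, Module.End K (M i)) →+* Module.End K (∀ i, M i) where
  toFun f := LinearMap.pi fun i => (f i).comp (LinearMap.proj i)
  map_one' := rfl
  map_mul' _ _ := rfl
  map_zero' := rfl
  map_add' _ _ := rfl

/-! ### Bordering by a rank-one map -/

/-- If `e` is idempotent with range in the hyperplane `ker φ`, and `q` is nilpotent, then `e + q`
can be altered by the rank-one map with form `φ` and any vector `x + z + s` of the indicated shape: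
`x + z` is absorbed by `e`, which stays idempotent, and `s` by `q`, whose nilpotency index grows by
at most one because `q s = 0` and `φ s = 0`. -/
theorem isNilCleanElem_border {K V : Type*} [Field K] [AddCommGroup V] [Module K V]
    {e q : Module.End K V} (φ : V →ₗ[K] K) {x z s : V} {k : ℕ}
    (he : IsIdempotentElem e) (hq : q ^ k = 0) (hφe : ∀ y, φ (e y) = 0)
    (hex : e x = 0) (hφx : φ x = 1) (hez : e z = 0) (hφz : φ z = 0) (hqs : q s = 0)
    (hφs : φ s = 0) :
    IsNilCleanElem (k + 1) (e + q + φ.smulRight (x + z + s)) := by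
  refine ⟨e + φ.smulRight (x + z), ?_, ?_⟩
  · ext y
    have h2 : e (e y) = e y := LinearMap.congr_fun he y
    simp [h2, hφe, hex, hez, hφx, hφz]
  · have hsub : e + q + φ.smulRight (x + z + s) - (e + φ.smulRight (x + z))
        = q + φ.smulRight s := by
      ext y
      simp only [LinearMap.sub_apply, LinearMap.add_apply, LinearMap.smulRight_apply, smul_add]
      abel
    have hpow : ∀ j : ℕ, (q + φ.smulRight s) ^ (j + 1)
        = q ^ (j + 1) + (φ ∘ₗ (q ^ j)).smulRight s := by
      intro j
      induction j with
      | zero => ext y; simp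
      | succ j ih =>
        rw [pow_succ', ih]
        ext y
        have h3 : (q ^ (j + 1)) y = q ((q ^ j) y) := by rw [pow_succ']; rfl
        have h4 : (q ^ (j + 2)) y = q ((q ^ (j + 1)) y) := by rw [pow_succ']; rfl
        simp [hqs, hφs, h3, h4]
    rw [hsub, hpow, pow_succ, hq]
    ext y
    simp

/-! ### Hessenberg bases of a cyclic space -/

/-- The Krylov sequence of `v` with shifts `δ`: its `i`-th vector is
`(C - δ (i - 1)) ⋯ (C - δ 0) v`. -/
def shiftedKrylov {K V : Type*} [Field K] [AddCommGroup V] [Module K V] (C : Module.End K V)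
    (v : V) (δ : ℕ → K) : ℕ → V
  | 0 => v
  | i + 1 => C (shiftedKrylov C v δ i) - δ i • shiftedKrylov C v δ i

section Krylov

variable {K V : Type*} [Field K] [AddCommGroup V] [Module K V] (C : Module.End K V)
    (v : V) (δ : ℕ → K)

theorem apply_shiftedKrylov (i : ℕ) :
    C (shiftedKrylov C v δ i) = shiftedKrylov C v δ (i + 1) + δ i • shiftedKrylov C v δ i := by
  simp [shiftedKrylov]

theorem pow_apply_mem_span_shiftedKrylov (i : ℕ) :
    (C ^ i) v ∈ Submodule.span K (shiftedKrylov C v δ '' Set.Iic i) := by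
  induction i with
  | zero => exact Submodule.subset_span ⟨0, by simp, rfl⟩
  | succ i ih =>
    rw [pow_succ']
    have hle : Submodule.span K (shiftedKrylov C v δ '' Set.Iic i) ≤
        (Submodule.span K (shiftedKrylov C v δ '' Set.Iic (i + 1))).comap C := by
      rw [Submodule.span_le]
      rintro _ ⟨j, hj, rfl⟩
      have hj' : j ≤ i := hj
      rw [SetLike.mem_coe, Submodule.mem_comap, apply_shiftedKrylov]
      exact add_mem (Submodule.subset_span ⟨j + 1, by simpa using hj', rfl⟩)
        (Submodule.smul_mem _ _ (Submodule.subset_span ⟨j, by simp; omega, rfl⟩))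
    exact hle ih

/-- If `v, C v, …, C ^ (n - 1) v` is a basis, then so are the first `n` shifted Krylov vectors, for
every choice of shifts. -/
theorem exists_basis_shiftedKrylov {n : ℕ} (B : Module.Basis (Fin n) K V)
    (hB : ∀ i, B i = (C ^ (i : ℕ)) v) :
    ∃ b : Module.Basis (Fin n) K V, ∀ i, b i = shiftedKrylov C v δ i := by
  have hspan : ⊤ ≤ Submodule.span K (Set.range fun i : Fin n => shiftedKrylov C v δ i) := by
    rw [← B.span_eq, Submodule.span_le]
    rintro _ ⟨i, rfl⟩
    rw [hB]
    refine Submodule.span_mono ?_ (pow_apply_mem_span_shiftedKrylov C v δ i)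
    rintro _ ⟨j, hj, rfl⟩
    exact ⟨⟨j, lt_of_le_of_lt hj i.2⟩, rfl⟩
  refine ⟨basisOfTopLeSpanOfCardEqFinrank _ hspan ?_, fun i => ?_⟩
  · rw [Module.finrank_eq_card_basis B]
  · simp

/-- In a shifted Krylov basis, the one diagonal entry of `C` not given by a shift is determined by
the trace. -/
theorem trace_eq_sum_add_coord {N : ℕ} (b : Module.Basis (Fin (N + 1)) K V)
    (hb : ∀ i, b i = shiftedKrylov C v δ i) :
    LinearMap.trace K V C
      = ∑ i ∈ Finset.range N, δ i + b.coord (Fin.last N) (C (b (Fin.last N))) := by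
  rw [LinearMap.trace_eq_matrix_trace K b, Matrix.trace, Fin.sum_univ_castSucc,
    ← Fin.sum_univ_eq_sum_range]
  congr 1
  · refine Finset.sum_congr rfl fun i _ => ?_
    have hC : C (b i.castSucc) = b i.succ + δ i • b i.castSucc := by
      rw [hb, hb]; exact apply_shiftedKrylov C v δ i
    rw [Matrix.diag_apply, LinearMap.toMatrix_apply, hC]
    simp [Fin.ext_iff]
  · simp [LinearMap.toMatrix_apply]

end Krylov

/-! ### Cyclic operators over the field with two elements -/

/-- The sequence of shifts that is `0` on the first `m` indices and continues `0, 1, 0, 1, …`. -/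
def pairShift (m i : ℕ) : ZMod 2 := if m < i ∧ (i - m) % 2 = 1 then 1 else 0

theorem sum_pairShift (m k : ℕ) : ∑ i ∈ Finset.range (m + 2 * k), pairShift m i = k := by
  induction k with
  | zero =>
    refine (Finset.sum_eq_zero fun i hi => ?_).trans (by simp)
    have : i < m := by simpa using hi
    rw [pairShift, if_neg (by omega)]
  | succ k ih =>
    rw [show m + 2 * (k + 1) = m + 2 * k + 1 + 1 by ring, Finset.sum_range_succ,
      Finset.sum_range_succ, ih, pairShift, pairShift, if_neg (by omega), if_pos (by omega)]
    simp

section Cyclic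

variable {V : Type*} [AddCommGroup V] [Module (ZMod 2) V] (C : Module.End (ZMod 2) V) (v : V)

/-- The case in which the last vector of the shifted Krylov basis reappears with coefficient `1` in
its own image. The bound `m ≤ 3` limits the length of the initial chain of arrows in the nilpotent
part. -/
theorem isNilCleanElem_of_coord_eq_one (m k : ℕ) (hm : m ≤ 3)
    (b : Module.Basis (Fin (m + 2 * k + 1)) (ZMod 2) V)
    (hb : ∀ i, b i = shiftedKrylov C v (pairShift m) i)
    (hw : b.coord (Fin.last _) (C (b (Fin.last _))) = 1) : IsNilCleanElem 5 C := by
  set u := shiftedKrylov C v (pairShift m) with hu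
  set φ := b.coord (Fin.last (m + 2 * k)) with hφ
  have hCu : ∀ i, C (u i) = u (i + 1) + pairShift m i • u i := apply_shiftedKrylov _ _ _
  have hub : ∀ i (h : i < m + 2 * k + 1), u i = b ⟨i, h⟩ := fun i h => (hb ⟨i, h⟩).symm
  have hφu : ∀ i < m + 2 * k, φ (u i) = 0 := fun i h => by
    rw [hub i (by omega), hφ, Module.Basis.coord_apply, Module.Basis.repr_self,
      Finsupp.single_apply, if_neg]
    simp only [Fin.ext_iff, Fin.val_last]; omega
  have hφN : φ (u (m + 2 * k)) = 1 := by
    rw [hub _ (by omega), hφ, Module.Basis.coord_apply, Module.Basis.repr_self,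
      Finsupp.single_apply, if_pos]
    simp [Fin.ext_iff]
  -- `e` and `q` share out the arrows `u i ↦ u (i + 1)`: `e` gets the one inside each pair, along
  -- with the diagonal entry `1` of that pair, and `q` gets all others. Both vanish on the last
  -- vector.
  let e : Module.End (ZMod 2) V := b.constr (ZMod 2) fun i =>
    if (i : ℕ) = m + 2 * k ∨ (i : ℕ) < m then 0
    else if ((i : ℕ) - m) % 2 = 0 then u (i + 1) else u i
  let q : Module.End (ZMod 2) V := b.constr (ZMod 2) fun i =>
    if (i : ℕ) = m + 2 * k then 0
    else if m ≤ (i : ℕ) ∧ ((i : ℕ) - m) % 2 = 0 then 0 else u (i + 1)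
  have he : ∀ i ≤ m + 2 * k, e (u i) = if i = m + 2 * k ∨ i < m then 0
      else if (i - m) % 2 = 0 then u (i + 1) else u i := fun i h =>
    (congrArg _ (hub i (by omega))).trans (b.constr_basis _ _ _)
  have hq : ∀ i ≤ m + 2 * k, q (u i) = if i = m + 2 * k then 0
      else if m ≤ i ∧ (i - m) % 2 = 0 then 0 else u (i + 1) := fun i h =>
    (congrArg _ (hub i (by omega))).trans (b.constr_basis _ _ _)
  have hext : ∀ f g : Module.End (ZMod 2) V, (∀ i ≤ m + 2 * k, f (u i) = g (u i)) → f = g :=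
    fun f g h => b.ext fun i => by rw [hb]; exact h i (by omega)
  have heN : e (u (m + 2 * k)) = 0 := by rw [he _ le_rfl, if_pos (by simp)]
  have hqN : q (u (m + 2 * k)) = 0 := by rw [hq _ le_rfl, if_pos rfl]
  have he0 : ∀ i < m, e (u i) = 0 := fun i h => by rw [he _ (by omega), if_pos (by omega)]
  have he1 : ∀ j < k, e (u (m + 2 * j)) = u (m + 2 * j + 1) := fun j h => by
    rw [he _ (by omega), if_neg (by omega), if_pos (by omega)]
  have he2 : ∀ j < k, e (u (m + 2 * j + 1)) = u (m + 2 * j + 1) := fun j h => by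
    rw [he _ (by omega), if_neg (by omega), if_neg (by omega)]
  have hq0 : ∀ i < m, q (u i) = u (i + 1) := fun i h => by
    rw [hq _ (by omega), if_neg (by omega), if_neg (by omega)]
  have hq1 : ∀ j ≤ k, q (u (m + 2 * j)) = 0 := fun j h => by
    rcases h.lt_or_eq with h | rfl
    · rw [hq _ (by omega), if_neg (by omega), if_pos (by omega)]
    · exact hqN
  have hq2 : ∀ j < k, q (u (m + 2 * j + 1)) = u (m + 2 * (j + 1)) := fun j h => by
    rw [hq _ (by omega), if_neg (by omega), if_neg (by omega)]; rfl
  have hcases : ∀ i ≤ m + 2 * k, i < m ∨ (∃ j < k, i = m + 2 * j) ∨ (∃ j < k, i = m + 2 * j + 1)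
      ∨ i = m + 2 * k := fun i h => by
    by_cases h1 : i < m
    · exact .inl h1
    by_cases h2 : i = m + 2 * k
    · exact .inr (.inr (.inr h2))
    rcases Nat.mod_two_eq_zero_or_one (i - m) with h3 | h3
    · exact .inr (.inl ⟨(i - m) / 2, by omega, by omega⟩)
    · exact .inr (.inr (.inl ⟨(i - m) / 2, by omega, by omega⟩))
  have heid : IsIdempotentElem e := hext _ _ fun i hi => by
    rw [Module.End.mul_apply]
    rcases hcases i hi with h | ⟨j, h, rfl⟩ | ⟨j, h, rfl⟩ | rfl
    · rw [he0 i h, map_zero]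
    · rw [he1 j h, he2 j h]
    · rw [he2 j h, he2 j h]
    · rw [heN, map_zero]
  have hq4 : q ^ 4 = 0 := hext _ _ fun i hi => by
    have h4 : (q ^ 4) (u i) = q (q (q (q (u i)))) := rfl
    rw [h4, LinearMap.zero_apply]
    rcases hcases i hi with h | ⟨j, h, rfl⟩ | ⟨j, h, rfl⟩ | rfl
    · have hm0 : q (u m) = 0 := hq1 0 (by omega)
      obtain h1 | h1 | h1 : i + 1 = m ∨ i + 2 = m ∨ i + 3 = m := by omega
      · rw [hq0 i h, h1, hm0]; simp
      · rw [hq0 i h, hq0 (i + 1) (by omega), h1, hm0]; simp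
      · rw [hq0 i h, hq0 (i + 1) (by omega), hq0 (i + 2) (by omega), h1, hm0]
    · rw [hq1 j h.le]; simp
    · rw [hq2 j h, hq1 (j + 1) h]; simp
    · rw [hqN]; simp
  -- No pair contains the last vector, so `e` never reaches it.
  have hφe : ∀ y, φ (e y) = 0 := by
    suffices h : φ ∘ₗ e = 0 from fun y => LinearMap.congr_fun h y
    refine b.ext fun i => ?_
    rw [hb, LinearMap.comp_apply, LinearMap.zero_apply]
    rcases hcases i (by omega) with h | ⟨j, h, h'⟩ | ⟨j, h, h'⟩ | h'
    · rw [he0 i h, map_zero]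
    · rw [h', he1 j h, hφu _ (by omega)]
    · rw [h', he2 j h, hφu _ (by omega)]
    · rw [h', heN, map_zero]
  -- The hyperplane `ker φ` is the sum of its intersections with `ker e` and `ker q`.
  have hdec : ∀ w, w - φ w • u (m + 2 * k) ∈
      (LinearMap.ker e ⊓ LinearMap.ker φ) ⊔ (LinearMap.ker q ⊓ LinearMap.ker φ) := by
    set S := (LinearMap.ker e ⊓ LinearMap.ker φ) ⊔ (LinearMap.ker q ⊓ LinearMap.ker φ)
    suffices h : ⊤ ≤ S.comap (LinearMap.id - φ.smulRight (u (m + 2 * k))) from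
      fun w => h (x := w) trivial
    rw [← b.span_eq, Submodule.span_le]
    rintro _ ⟨i, rfl⟩
    change b i - φ (b i) • u (m + 2 * k) ∈ S
    rw [hb]
    rcases hcases i (by omega) with h | ⟨j, h, h'⟩ | ⟨j, h, h'⟩ | h'
    · rw [hφu _ (by omega), zero_smul, sub_zero]
      exact Submodule.mem_sup_left ⟨he0 i h, hφu _ (by omega)⟩
    · rw [h', hφu _ (by omega), zero_smul, sub_zero]
      exact Submodule.mem_sup_right ⟨hq1 j h.le, hφu _ (by omega)⟩
    · rw [h', hφu _ (by omega), zero_smul, sub_zero]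
      -- `e` takes the same value on both vectors of a pair, and `q` kills the first of them.
      refine Submodule.mem_sup.2 ⟨u (m + 2 * j + 1) - u (m + 2 * j), ⟨?_, ?_⟩,
        u (m + 2 * j), ⟨hq1 j h.le, hφu _ (by omega)⟩, sub_add_cancel _ _⟩
      · rw [SetLike.mem_coe, LinearMap.mem_ker, map_sub, he1 j h, he2 j h, sub_self]
      · rw [SetLike.mem_coe, LinearMap.mem_ker, map_sub, hφu _ (by omega), hφu _ (by omega),
          sub_self]
    · rw [h', hφN, one_smul, sub_self]
      exact zero_mem _
  have hlast : b (Fin.last _) = u (m + 2 * k) := hb _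
  rw [hlast] at hw
  obtain ⟨z, ⟨hz1, hz2⟩, s, ⟨hs1, hs2⟩, hzs⟩ := Submodule.mem_sup.1 (hdec (C (u (m + 2 * k))))
  have hC : C = e + q + φ.smulRight (u (m + 2 * k) + z + s) := hext _ _ fun i hi => by
    simp only [LinearMap.add_apply, LinearMap.smulRight_apply]
    rcases hcases i hi with h | ⟨j, h, rfl⟩ | ⟨j, h, rfl⟩ | rfl
    · rw [hCu, he0 i h, hq0 i h, hφu _ (by omega), pairShift, if_neg (by omega)]; simp
    · rw [hCu, he1 j h, hq1 j h.le, hφu _ (by omega), pairShift, if_neg (by omega)]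
      simp
    · rw [hCu, he2 j h, hq2 j h, hφu _ (by omega), pairShift, if_pos (by omega), one_smul,
        zero_smul, add_zero, add_comm]
      rfl
    · rw [heN, hqN, hφN, one_smul, add_assoc (u _) z s, hzs, hw, one_smul]
      abel
  rw [hC]
  exact isNilCleanElem_border φ heid hq4 hφe heN hφN hz1 hz2 hs1 hs2

theorem isNilCleanElem_of_mul_self_eq_smul_one {a : ZMod 2} (h : C * C = a • 1) :
    IsNilCleanElem 2 C := by
  have h2 : C + C = 0 := by
    ext y
    have : (2 : ZMod 2) • C y = 0 := by rw [show (2 : ZMod 2) = 0 from rfl, zero_smul]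
    simpa [two_smul] using this
  have ha : ∀ c : ZMod 2, c = 0 ∨ c = 1 := by decide
  obtain rfl | rfl := ha a
  · exact ⟨0, .zero, by rw [sub_zero, sq, h, zero_smul]⟩
  · refine ⟨1, .one, ?_⟩
    have h1 : (C - 1) ^ 2 = C * C - (C + C) + 1 := by noncomm_ring
    have h3 : (1 : Module.End (ZMod 2) V) + 1 = 0 := by
      ext y
      have : (2 : ZMod 2) • y = 0 := by rw [show (2 : ZMod 2) = 0 from rfl, zero_smul]
      simpa [two_smul] using this
    rw [h1, h, h2, one_smul, sub_zero, h3]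

/-- In dimension one or two with trace zero, the square of `C` is a scalar. -/
theorem isNilCleanElem_of_cyclic_small {N : ℕ} (hN : N ≤ 1)
    (b : Module.Basis (Fin (N + 1)) (ZMod 2) V) (hb : ∀ i, b i = shiftedKrylov C v 0 i)
    (hw : b.coord (Fin.last N) (C (b (Fin.last N))) = 0) : IsNilCleanElem 2 C := by
  have hC0 : ∀ i, C (shiftedKrylov C v 0 i) = shiftedKrylov C v 0 (i + 1) := fun i => by
    rw [apply_shiftedKrylov]; simp
  obtain rfl | rfl : N = 0 ∨ N = 1 := by omega
  · have h0 : C (b 0) = 0 := by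
      rw [← b.sum_repr (C (b 0))]
      simpa using Or.inl hw
    refine isNilCleanElem_of_mul_self_eq_smul_one C (a := 0) (b.ext fun i => ?_)
    obtain rfl : i = 0 := Fin.ext (by omega)
    simp [h0]
  · have h0 : C (b 0) = b 1 := by rw [hb, hb]; exact hC0 0
    have h1 : C (b 1) = b.repr (C (b 1)) 0 • b 0 := by
      have h := b.sum_repr (C (b 1))
      rw [Fin.sum_univ_two, show b.repr (C (b 1)) 1 = 0 from hw, zero_smul, add_zero] at h
      exact h.symm
    refine isNilCleanElem_of_mul_self_eq_smul_one C (a := b.repr (C (b 1)) 0)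
      (b.ext fun i => ?_)
    rw [Module.End.mul_apply, LinearMap.smul_apply, Module.End.one_apply]
    fin_cases i
    · change C (C (b 0)) = _
      rw [h0, h1]
      simp
    · change C (C (b 1)) = _ • b 1
      conv_lhs => rw [h1, map_smul, h0]

theorem isNilCleanElem_of_cyclic {n : ℕ} (B : Module.Basis (Fin n) (ZMod 2) V)
    (hB : ∀ i, B i = (C ^ (i : ℕ)) v) : IsNilCleanElem 5 C := by
  rcases n with _ | N
  · exact ⟨0, .zero, B.ext fun i => i.elim0⟩
  have htwo : ∀ t s : ZMod 2, t = s + 1 ∨ t = s := by decide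
  have key : ∀ m k, m ≤ 3 → N = m + 2 * k → LinearMap.trace (ZMod 2) V C = k + 1 →
      IsNilCleanElem 5 C := by
    rintro m k hm rfl ht
    obtain ⟨b, hb⟩ := exists_basis_shiftedKrylov C v (pairShift m) B hB
    rw [trace_eq_sum_add_coord C v _ b hb, sum_pairShift] at ht
    exact isNilCleanElem_of_coord_eq_one C v m k hm b hb (add_left_cancel ht)
  -- Replacing `(m, k)` by `(m + 2, k - 1)` keeps the dimension and changes the parity of `k`.
  rcases htwo (LinearMap.trace (ZMod 2) V C) (N / 2 : ℕ) with ht | ht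
  · exact key (N % 2) (N / 2) (by omega) (by omega) ht
  by_cases hN : N ≤ 1
  · obtain ⟨b, hb⟩ := exists_basis_shiftedKrylov C v 0 B hB
    rw [trace_eq_sum_add_coord C v _ b hb, Nat.div_eq_of_lt (by omega)] at ht
    exact (isNilCleanElem_of_cyclic_small C v hN b hb (by simpa using ht)).mono (by omega)
  · refine key (N % 2 + 2) (N / 2 - 1) (by omega) (by omega) ?_
    rw [ht, show N / 2 = N / 2 - 1 + 1 by omega]
    simp

end Cyclic

/-! ### Reduction to cyclic operators -/

open Polynomial in
theorem isNilCleanElem_mulLeft_root {f : (ZMod 2)[X]} (hf : f ≠ 0) :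
    IsNilCleanElem 5 (LinearMap.mulLeft (ZMod 2) (AdjoinRoot.root f)) :=
  isNilCleanElem_of_cyclic _ 1 (AdjoinRoot.powerBasis hf).basis fun i => by
    simp [LinearMap.pow_mulLeft]

open Polynomial in
theorem isNilCleanElem_lsmul_quotient_span {f : (ZMod 2)[X]} (hf : f ≠ 0) :
    IsNilCleanElem 5
      (Algebra.lsmul (ZMod 2) (ZMod 2) ((ZMod 2)[X] ⧸ Submodule.span (ZMod 2)[X] {f})
        (X : (ZMod 2)[X])) := by
  refine (isNilCleanElem_mulLeft_root hf).of_linearEquiv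
    { AddEquiv.refl (AdjoinRoot f) with map_smul' := fun _ _ => rfl } fun m => ?_
  induction m using Submodule.Quotient.induction_on with | _ p
  rfl

open Polynomial in
/-- Every endomorphism of a finite-dimensional space over the field with two elements is the sum of
an idempotent and a nilpotent whose index is bounded independently of the dimension. -/
theorem isNilCleanElem_end {V : Type} [AddCommGroup V] [Module (ZMod 2) V]
    [Module.Finite (ZMod 2) V] (C : Module.End (ZMod 2) V) : IsNilCleanElem 5 C := by
  classical
  obtain ⟨ι, _, p, hp, e, ⟨ψ⟩⟩ := Module.equiv_directSum_of_isTorsion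
    (Module.AEval.isTorsion_of_finiteDimensional (ZMod 2) V C)
  let M : ι → Type := fun i => (ZMod 2)[X] ⧸ Submodule.span (ZMod 2)[X] {p i ^ e i}
  let ψ' : Module.AEval (ZMod 2) V C ≃ₗ[(ZMod 2)[X]] ∀ i, M i :=
    ψ.trans (DirectSum.linearEquivFunOnFintype (ZMod 2)[X] ι M)
  have hM : IsNilCleanElem 5
      (piEndHom (ZMod 2) M fun i => Algebra.lsmul (ZMod 2) (ZMod 2) (M i) (X : (ZMod 2)[X])) :=
    (IsNilCleanElem.pi fun i =>
      isNilCleanElem_lsmul_quotient_span (pow_ne_zero (e i) (hp i).ne_zero)).map _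
  refine hM.of_linearEquiv ((Module.AEval.of (ZMod 2) V C).trans (ψ'.restrictScalars (ZMod 2)))
    fun m => ?_
  change ψ' (Module.AEval.of (ZMod 2) V C (C • m)) = _
  rw [← Module.AEval.X_smul_of, map_smul]
  rfl

theorem Matrix.isNilCleanElem_zmod_two {n : ℕ} (a : Matrix (Fin n) (Fin n) (ZMod 2)) :
    IsNilCleanElem 5 a := by
  have := (isNilCleanElem_end (Matrix.toLinAlgEquiv' a)).map
    (Matrix.toLinAlgEquiv' (R := ZMod 2) (n := Fin n)).symm.toAlgHom.toRingHom
  simpa using this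

/-! ### Unit-regularity and its consequences -/

theorem Matrix.exists_isUnit_eq_mul_mul_zmod_two {n : ℕ} (a : Matrix (Fin n) (Fin n) (ZMod 2)) :
    ∃ u, IsUnit u ∧ a = a * u * a := by
  obtain ⟨L, L', D, h⟩ := Matrix.Pivot.exists_list_transvec_mul_diagonal_mul_list_transvec a
  have hunit : ∀ L : List (Matrix.TransvectionStruct (Fin n) (ZMod 2)),
      IsUnit (L.map Matrix.TransvectionStruct.toMatrix).prod := fun L => by
    rw [Matrix.isUnit_iff_isUnit_det, Matrix.TransvectionStruct.det_toMatrix_prod]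
    exact isUnit_one
  obtain ⟨P, hP⟩ := hunit L
  obtain ⟨Q, hQ⟩ := hunit L'
  have hD : Matrix.diagonal D * Matrix.diagonal D = Matrix.diagonal D := by
    rw [Matrix.diagonal_mul_diagonal]
    congr 1
    ext i
    generalize D i = d
    revert d
    decide
  rw [← hP, ← hQ] at h
  refine ⟨↑(Q⁻¹ * P⁻¹), Units.isUnit _, ?_⟩
  rw [h]
  calc (P * Matrix.diagonal D * Q : Matrix (Fin n) (Fin n) (ZMod 2))
      = P * (Matrix.diagonal D * Matrix.diagonal D) * Q := by rw [hD]
    _ = _ := by simp [mul_assoc, -Matrix.diagonal_mul_diagonal]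

theorem IsUnitRegularRing.isDRegularlyNilCleanRingOfIndexAtMost_two {R : Type*} [Ring R]
    (h : IsUnitRegularRing R) : IsDRegularlyNilCleanRingOfIndexAtMost R 2 := by
  refine ⟨two_pos, fun a => ?_⟩
  obtain ⟨u, -, hu⟩ := h (a * a)
  -- `r` is a reflexive inner inverse of `a ^ 2`.
  set r := u * (a * a) * u with hr
  have h1 : a * a * r * (a * a) = a * a := by
    calc a * a * r * (a * a) = (a * a * u * (a * a)) * u * (a * a) := by
          rw [hr]; simp only [mul_assoc]
      _ = a * a := by rw [← hu, ← hu]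
  have h2 : r * (a * a) * r = r := by
    calc r * (a * a) * r = u * ((a * a * u * (a * a)) * u * (a * a)) * u := by
          rw [hr]; simp only [mul_assoc]
      _ = r := by rw [← hu, ← hu]
  refine ⟨a * r * a, ⟨r, rfl⟩, ?_, ?_⟩
  · calc a * r * a * (a * r * a) = a * (r * (a * a) * r) * a := by simp only [mul_assoc]
      _ = a * r * a := by rw [h2]
  · calc (a * (1 - a * r * a)) ^ 2
        = (a * a - a * a * r * (a * a)) * (1 - a * r * a) := by noncomm_ring
      _ = 0 := by rw [h1, sub_self, zero_mul]

/-! ### Strong cleanness -/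

/-- If `a ^ i = a ^ (i + p)` with `p > 0`, then `a ^ k` is idempotent for every multiple `k ≥ i` of
`p`. -/
theorem exists_pos_isIdempotentElem_pow {M : Type*} [Monoid M] [Finite M] (a : M) :
    ∃ k, 0 < k ∧ IsIdempotentElem (a ^ k) := by
  obtain ⟨i, j, hne, hij⟩ := Finite.exists_ne_map_eq_of_infinite fun n : ℕ => a ^ n
  wlog hlt : i < j generalizing i j
  · exact this j i hne.symm hij.symm (by omega)
  obtain ⟨p, rfl⟩ := Nat.exists_eq_add_of_lt hlt
  have hper : ∀ c, a ^ (i + (p + 1) * c) = a ^ i := fun c => by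
    induction c with
    | zero => simp
    | succ c ih =>
      rw [show i + (p + 1) * (c + 1) = i + (p + 1) * c + (p + 1) by ring, pow_add, ih, ← pow_add]
      exact hij.symm
  refine ⟨(p + 1) * (i + 1), by positivity, ?_⟩
  obtain ⟨d, hd⟩ : ∃ d, (p + 1) * (i + 1) = i + d := ⟨p * i + p + 1, by ring⟩
  calc a ^ ((p + 1) * (i + 1)) * a ^ ((p + 1) * (i + 1))
      = a ^ (i + (p + 1) * (i + 1)) * a ^ d := by
        rw [← pow_add, ← pow_add]; congr 1; omega
    _ = a ^ ((p + 1) * (i + 1)) := by rw [hper, ← pow_add, hd]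

/-- For an idempotent power `f = a ^ k`, the element `a` is invertible on the corner of `f`, and `1 - a`
is invertible on the complementary corner, where `a` is nilpotent; hence `a - (1 - f)` is a unit. -/
theorem isStronglyCleanRing_of_finite {R : Type*} [Ring R] [Finite R] :
    IsStronglyCleanRing R := by
  intro a
  obtain ⟨k, hk, hf⟩ := exists_pos_isIdempotentElem_pow a
  obtain ⟨l, rfl⟩ : ∃ l, k = l + 1 := ⟨k - 1, by omega⟩
  set f := a ^ (l + 1) with hfdef
  have haf : Commute a f := Commute.pow_right rfl _
  set s := ∑ i ∈ Finset.range (l + 1), a ^ i with hs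
  have has : Commute a s := Commute.sum_right _ _ _ fun i _ => Commute.pow_right rfl _
  have hfs : Commute f s := has.pow_left _
  have hal : Commute a (a ^ l) := Commute.pow_right rfl _
  have hfl : Commute f (a ^ l) := hal.pow_left _
  -- The inverse of `a - (1 - f)` is `a ^ l` on the corner of `f` and `-s` on the other one.
  have hgeom : (1 - a) * s = 1 - f := by
    rw [hs, hfdef, mul_neg_geom_sum]
  have hcomm : Commute (a - (1 - f)) (a ^ l * f - (1 - f) * s) := by
    refine Commute.sub_left ?_ ?_
    · exact (hal.mul_right haf).sub_right (((Commute.one_right a).sub_right haf).mul_right has)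
    · refine Commute.sub_left (Commute.one_left _) ?_
      exact (hfl.mul_right rfl).sub_right
        (((Commute.one_right f).sub_right rfl).mul_right hfs)
  have hff : f * f = f := hf
  have hprod : (a - (1 - f)) * (a ^ l * f - (1 - f) * s) = 1 := by
    have e1 : a * (a ^ l * f) = f := by rw [← mul_assoc, ← pow_succ', ← hfdef, hff]
    have e2 : (1 - f) * (a ^ l * f) = 0 := by
      rw [sub_mul, one_mul, ← mul_assoc, hfl.eq, mul_assoc, hff, sub_self]
    have e3 : (1 - f) * ((1 - f) * s) = (1 - f) * s := by
      rw [← mul_assoc, hf.one_sub.eq]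
    have e4 : a * ((1 - f) * s) = (1 - f) * (a * s) := by
      rw [← mul_assoc, ← mul_assoc, ((Commute.one_right a).sub_right haf).eq]
    have e5 : a * s = s - (1 - f) := by rw [← hgeom, sub_mul, one_mul, sub_sub_cancel]
    rw [sub_mul, mul_sub, mul_sub, e1, e2, e3, e4, e5, mul_sub, hf.one_sub.eq]
    abel
  refine ⟨a - (1 - f), 1 - f, ⟨⟨_, _, hprod, hcomm.eq ▸ hprod⟩, rfl⟩, hf.one_sub, by abel, ?_⟩
  exact (((Commute.one_right a).sub_right haf).sub_left rfl).eq

/-! ### The nilpotent shift -/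

/-- The nilpotent Jordan block of size `n`, with ones just above the diagonal. -/
def nilpotentShift (n : ℕ) : Matrix (Fin n) (Fin n) (ZMod 2) :=
  Matrix.of fun i j => if (i : ℕ) + 1 = j then 1 else 0

theorem nilpotentShift_pow_apply (n k : ℕ) (i j : Fin n) :
    (nilpotentShift n ^ k) i j = if (i : ℕ) + k = j then 1 else 0 := by
  induction k generalizing i with
  | zero => simp [Matrix.one_apply, Fin.ext_iff]
  | succ k ih =>
    have h1 : ∀ l, nilpotentShift n i l = if (i : ℕ) + 1 = l then 1 else 0 := fun _ => rfl
    rw [pow_succ', Matrix.mul_apply]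
    simp only [ih, h1]
    by_cases h : (i : ℕ) + 1 < n
    · rw [Finset.sum_eq_single ⟨i + 1, h⟩]
      · simp [add_assoc, add_comm 1 k]
      · intro l _ hl
        rw [if_neg, zero_mul]
        exact fun h' => hl (Fin.ext h'.symm)
      · simp
    · rw [if_neg (by omega)]
      refine Finset.sum_eq_zero fun l _ => ?_
      rw [if_neg (by omega), zero_mul]

theorem nilpotentShift_pow_eq_zero {n k : ℕ} (h : n ≤ k) : nilpotentShift n ^ k = 0 := by
  ext i j
  rw [nilpotentShift_pow_apply, if_neg (by omega)]
  rfl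

theorem nilpotentShift_pow_ne_zero {n k : ℕ} (h : k < n) : nilpotentShift n ^ k ≠ 0 := fun h0 => by
  have := congr_fun (congr_fun h0 ⟨0, by omega⟩) ⟨k, h⟩
  rw [nilpotentShift_pow_apply] at this
  simp at this

theorem not_isStronglyPiRegularRing_prodMatrixZModTwo :
    ¬ IsStronglyPiRegularRing ProdMatrixZModTwo := by
  intro h
  obtain ⟨n, -, ⟨x, hx⟩, -⟩ := h fun n => nilpotentShift n
  have hn : nilpotentShift n.succPNat ^ n = nilpotentShift n.succPNat ^ (n + 1) * x n.succPNat :=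
    congr_fun hx n.succPNat
  rw [nilpotentShift_pow_eq_zero n.succPNat_coe.le, zero_mul] at hn
  exact nilpotentShift_pow_ne_zero (n.lt_succ_self.trans_eq n.succPNat_coe.symm) hn

theorem not_isDRegularlyNilCleanRingOfIndexAtMost_one :
    ¬ IsDRegularlyNilCleanRingOfIndexAtMost ProdMatrixZModTwo 1 := by
  rintro ⟨-, h⟩
  obtain ⟨e, ⟨r, hr⟩, he, ha⟩ := h fun n => nilpotentShift n
  have hr2 : e 2 = nilpotentShift (2 : ℕ+) * r 2 * nilpotentShift (2 : ℕ+) := congr_fun hr 2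
  have he2 : e 2 * e 2 = e 2 := congr_fun he 2
  have ha2 : (nilpotentShift (2 : ℕ+) * (1 - e 2)) ^ 1 = 0 := congr_fun ha 2
  have hsq : nilpotentShift (2 : ℕ+) * nilpotentShift (2 : ℕ+) = 0 := by
    rw [← sq]; exact nilpotentShift_pow_eq_zero le_rfl
  have hne : nilpotentShift (2 : ℕ+) ≠ 0 := by
    rw [← pow_one (nilpotentShift _)]; exact nilpotentShift_pow_ne_zero one_lt_two
  generalize nilpotentShift (2 : ℕ+) = a at hr2 ha2 hsq hne
  generalize e 2 = f, r 2 = s at hr2 he2 ha2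
  -- `f ∈ aRa` squares to zero because `a` does, so the idempotent `f` vanishes.
  have hf : f = 0 := by
    rw [← he2, hr2]
    calc a * s * a * (a * s * a) = a * s * (a * a) * (s * a) := by simp only [mul_assoc]
      _ = 0 := by rw [hsq, mul_zero, zero_mul]
  rw [pow_one, hf, sub_zero, mul_one] at ha2
  exact hne ha2

theorem mainTheorem3 :
    (IsDRegularlyNilCleanRing ProdMatrixZModTwo ∧
      IsDRegularlyNilCleanRingOfIndex ProdMatrixZModTwo 2 ∧
      IsUnitRegularRing ProdMatrixZModTwo ∧
      IsStronglyCleanRing ProdMatrixZModTwo ∧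
      IsNilCleanRing ProdMatrixZModTwo ∧
      ¬ IsStronglyPiRegularRing ProdMatrixZModTwo) ∧
    ¬ ∀ (R : Type) [Ring R] [Nontrivial R],
        IsDRegularlyNilCleanRing R → IsStronglyPiRegularRing R := by
  have hunit : IsUnitRegularRing ProdMatrixZModTwo := fun a => by
    choose u hu ha using fun n => Matrix.exists_isUnit_eq_mul_mul_zmod_two (a n)
    exact ⟨u, Pi.isUnit_iff.2 hu, funext ha⟩
  have htwo := hunit.isDRegularlyNilCleanRingOfIndexAtMost_two
  have hD : IsDRegularlyNilCleanRing ProdMatrixZModTwo := fun a => by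
    obtain ⟨e, her, he, h⟩ := htwo.2 a
    exact ⟨e, her, he, 2, h⟩
  have hone : IsLeast {j | IsDRegularlyNilCleanRingOfIndexAtMost ProdMatrixZModTwo j} 2 := by
    refine ⟨htwo, fun j hj => ?_⟩
    by_contra! hlt
    obtain rfl : j = 1 := by have := hj.1; omega
    exact not_isDRegularlyNilCleanRingOfIndexAtMost_one hj
  have hclean : IsStronglyCleanRing ProdMatrixZModTwo := fun a => by
    choose u e hu he ha hc using fun n => isStronglyCleanRing_of_finite (a n)
    exact ⟨u, e, Pi.isUnit_iff.2 hu, funext he, funext ha, funext hc⟩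
  have hnil : IsNilCleanRing ProdMatrixZModTwo := fun a => by
    obtain ⟨e, he, h⟩ : IsNilCleanElem 5 a := .pi fun n => (a n).isNilCleanElem_zmod_two
    exact ⟨a - e, e, ⟨5, h⟩, he, (sub_add_cancel a e).symm⟩
  have hnot := not_isStronglyPiRegularRing_prodMatrixZModTwo
  exact ⟨⟨hD, hone, hunit, hclean, hnil, hnot⟩,
    fun h => hnot (@h ProdMatrixZModTwo _ ⟨0, 1, fun h01 => by
      have := congr_fun (congr_fun (congr_fun h01 1) 0) 0
      simp at this⟩ hD)⟩
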